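/- Customers arrive at a single-server queue according to a Poisson process with rate $\lambda>0$ and are served in order of arrival. With $n$ customers in the system, services are completed at rate $\mu_0>0$ if $1\le n\le K$ and at rate $\mu_1$ if $n>K$, where $K\ge 0$ is an integer and $\mu_1>\lambda$; thus the number $Q(t)$ of customers in the system is a birth-death Markov chain on $\{0,1,2,\dots\}$ with birth rate $\lambda$ and these death rates. Let $S(n,m)$ be the remaining sojourn time of a customer at position $n$ in the queue (counting the customer in service) with $m$ customers behind, i.e. the time until the $n$-th departure when the chain starts in $n+m$, and let $\psi(n,m,s)=\mathbb{E}[e^{-sS(n,m)}]$. Then $Q$ has a unique stationary distribution $(\pi_n)_{n\ge0}$, with $$\pi_0=\left(\sum_{n=0}^{K}\left(\frac{\lambda}{\mu_0}\right)^n+\frac{\lambda}{\mu_1-\lambda}\left(\frac{\lambda}{\mu_0}\right)^K\right)^{-1}.$$ Let $S^*$ be the sojourn time of a typical customer arriving in the stationary regime: the law of $S^*$ assigns to a set $A$ the expected number of customers who arrive in a unit time interval and have a sojourn time in $A$, divided by the expected number of customers who arrive in that interval, for the chain started from its stationary distribution. This is a probability law, and for all complex $s$ with $\operatorname{Re} s\ge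 0$ its Laplace transform $\psi(s)=\mathbb{E}[e^{-sS^*}]$ is $$\psi(s)=\pi_0\sum_{h=0}^{K-1}\left[\left(\frac{\lambda}{\mu_0}\right)^h\psi(h+1,0,s)+\left(\frac{\lambda}{\mu_0}\right)^K\left(\frac{\lambda}{\mu_1}\right)^h\left(\frac{\mu_1}{\mu_1+s}\right)^{h+1}\psi(K,h,s)\right]+\pi_0\left(\frac{\lambda}{\mu_0}\right)^K\left(\frac{\lambda}{\mu_1}\right)^K\frac{\mu_1}{\mu_1-\lambda}\left(\frac{\mu_1}{\mu_1+s}\right)^{2K}\frac{\mu_1-\lambda}{\mu_1-\lambda+s}.$$ -/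

import Mathlib

open MeasureTheory ProbabilityTheory
open scoped ENNReal

/-- Parameters of the queue: arrival rate `lam`, low service rate `mu0`, high service rate `mu1`
and threshold `K`. -/
structure SpeedQueue where
  lam : ℝ
  mu0 : ℝ
  mu1 : ℝ
  K : ℕ

namespace SpeedQueue

/-- The exponential distribution with rate `1` is a probability measure. -/
instance instIsProbabilityMeasureExpOne : IsProbabilityMeasure (expMeasure 1) :=
  isProbabilityMeasure_expMeasure one_pos

/-! ### The number of customers in the system: rates and stationary distribution -/

/-- Rate of service completions when `n` customers are present: the server idles if `n = 0`, works
at the low rate if `1 ≤ n ≤ K`, and at the high rate if `n > K`. -/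
noncomputable def serviceRate (q : SpeedQueue) (n : ℕ) : ℝ :=
  if n = 0 then 0 else if n ≤ q.K then q.mu0 else q.mu1

/-- Total rate of leaving state `n`. -/
noncomputable def totalRate (q : SpeedQueue) (n : ℕ) : ℝ := q.lam + q.serviceRate n

/-- Transition rate from state `n` to state `m ≠ n`. -/
noncomputable def jumpRate (q : SpeedQueue) (n m : ℕ) : ℝ :=
  if m = n + 1 then q.lam else if n = m + 1 then q.serviceRate n else 0

/-- `π` is a stationary distribution of the chain: in every state the probability flow in equals
the probability flow out. -/
def IsStationary (q : SpeedQueue) (π : PMF ℕ) : Prop :=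
  ∀ m, HasSum (fun n => (π n).toReal * q.jumpRate n m) ((π m).toReal * q.totalRate m)

/-! ### The continuous time Markov chain, built from its jump chain and its holding times -/

/-- The sources of randomness: for each jump, a uniform variable on `[0,1]`, which decides the
direction of the jump, and an exponential variable of rate `1`, which gives the holding time. -/
abbrev Source : Type := ℕ → unitInterval × ℝ

/-- All variables in the source are independent. -/
noncomputable def sourceLaw : Measure Source :=
  Measure.infinitePi fun _ => (volume : Measure unitInterval).prod (expMeasure 1)

/-- State after `j` jumps, from the initial state `k`. From `n` the chain jumps to `n + 1` with
probability `lam / (lam + serviceRate n)` and otherwise to `n - 1`. -/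
noncomputable def state (q : SpeedQueue) (k : ℕ) (ω : Source) : ℕ → ℕ
  | 0 => k
  | j + 1 =>
    if ((ω j).1 : ℝ) ≤ q.lam / q.totalRate (q.state k ω j) then q.state k ω j + 1
    else q.state k ω j - 1

/-- Time spent in the state reached after `j` jumps. -/
noncomputable def holdingTime (q : SpeedQueue) (k : ℕ) (ω : Source) (j : ℕ) : ℝ :=
  (ω j).2 / q.totalRate (q.state k ω j)

/-- Epoch of the `j`-th jump (epoch `0` for `j = 0`). -/
noncomputable def jumpEpoch (q : SpeedQueue) (k : ℕ) (ω : Source) (j : ℕ) : ℝ :=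
  ∑ i ∈ Finset.range j, q.holdingTime k ω i

/-- Number of departures among the first `i` jumps after the `j`-th one. -/
noncomputable def departures (q : SpeedQueue) (k : ℕ) (ω : Source) (j i : ℕ) : ℕ :=
  ((Finset.range i).filter fun l => q.state k ω (j + l + 1) < q.state k ω (j + l)).card

/-- Time from the `j`-th jump until `n` further customers have departed: the total length of the
periods, after the `j`-th jump, that begin when fewer than `n` customers have departed since. It
is `∞` if the `n`-th departure never comes. -/
noncomputable def departureDelay (q : SpeedQueue) (k : ℕ) (ω : Source) (j n : ℕ) : ℝ≥0∞ :=
  ∑' i, if q.departures k ω j i < n then ENNReal.ofReal (q.holdingTime k ω (j + i)) else 0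

/-! ### Sojourn times -/

/-- `S(n, m)`: remaining sojourn time of a customer at position `n` in the queue, with `m`
customers behind. There are `n + m` customers in the system, and as service is in order of
arrival, the customer leaves at the `n`-th departure. -/
noncomputable def taggedSojourn (q : SpeedQueue) (n m : ℕ) (ω : Source) : ℝ≥0∞ :=
  q.departureDelay (n + m) ω 0 n

/-- Laplace transform `𝔼[exp (-s S)]` of a law on `[0, ∞]`, with `exp (-s ∞) = 0`. -/
noncomputable def laplace (ν : Measure ℝ≥0∞) (s : ℂ) : ℂ :=
  ∫ x, (if x = ∞ then 0 else Complex.exp (-s * (x.toReal : ℂ))) ∂ν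

/-- `ψ(n, m, s) = 𝔼[exp (-s S(n, m))]`. -/
noncomputable def psi (q : SpeedQueue) (n m : ℕ) (s : ℂ) : ℂ :=
  laplace (sourceLaw.map (q.taggedSojourn n m)) s

/-- The event, for an initial state `p.1` and a source `p.2`, that the `(j + 1)`-st jump is an
arrival and occurs by time `1`. -/
def arrivalInWindow (q : SpeedQueue) (j : ℕ) : Set (ℕ × Source) :=
  {p | q.state p.1 p.2 (j + 1) = q.state p.1 p.2 j + 1 ∧ q.jumpEpoch p.1 p.2 (j + 1) ≤ 1}

/-- Sojourn time of the customer who arrives at the `(j + 1)`-st jump: service being in order of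
arrival, this customer leaves when as many departures have followed as there were customers in
the system just after the arrival. -/
noncomputable def arrivalSojourn (q : SpeedQueue) (j : ℕ) (p : ℕ × Source) : ℝ≥0∞ :=
  q.departureDelay p.1 p.2 (j + 1) (q.state p.1 p.2 (j + 1))

/-- For the chain with initial distribution `π`: the measure whose value at `A` is the expected
number of customers who arrive in the time window `(0, 1]` and whose sojourn time lies in `A`. -/
noncomputable def arrivalMeasure (q : SpeedQueue) (π : PMF ℕ) : Measure ℝ≥0∞ :=
  Measure.sum fun j =>
    ((π.toMeasure.prod sourceLaw).restrict (q.arrivalInWindow j)).map (q.arrivalSojourn j)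

/-- Law of the sojourn time `S*` of a typical customer who arrives when the system runs with
initial (stationary) distribution `π`, that is, the Palm distribution of the sojourn time: the
expected number of arrivals in a unit time window with sojourn time in `A`, divided by the
expected number of all arrivals in that window. -/
noncomputable def sojournLaw (q : SpeedQueue) (π : PMF ℕ) : Measure ℝ≥0∞ :=
  (q.arrivalMeasure π Set.univ)⁻¹ • q.arrivalMeasure π

end SpeedQueue

/-! Two facts carry the formula. The first is that arrivals see time averages
(`PositiveRates.sojournLaw_eq`): the law of S* is the mixture of the laws of S(k+1, 0) with weights
π k. The arrivals are sorted by the index j of their jump. Conditioning on the first jump writes the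
probability for j + 1 as an exponential average of those for j, and the renewal identity
`delayAverage_add` replaces this average by plain integrals over time. After summation against π,
detailed balance turns the flow from neighbouring states into the flow out of each state, so the
equations telescope in j (`PositiveRates.tsum_arrivalProb`). The remainder decays geometrically
since the rates are bounded, and only the term λt · ∑ π k P(S(k+1, 0) ∈ A) survives.

The second is the evaluation of ∑ π k ψ(k+1, 0, s). Terms with k < K are kept. From K on, π is
geometric with ratio ρ = λ/μ₁; put G m = ∑ ρ^h ψ(K+h+1, m, s). With more than K customers present
the first-step equation has constant coefficients, and summing it against ρ^h gives (μ₁+s) G m = λ G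
(m+1) + μ₁ ψ(K, m, s). Its only bounded solution is a series in m (`PositiveRates.hasSum_psi_add`).
For m ≥ K the tagged customer is served at the high rate throughout, so ψ(K, m, s) = (μ₁/(μ₁+s))^K
and the rest of the series is geometric (`PositiveRates.tsum_psi_tail`). -/

namespace SpeedQueue

/-! ### Averages over an exponential holding time -/

theorem lintegral_expMeasure_one (f : ℝ → ℝ≥0∞) (hf : Measurable f) :
    ∫⁻ x, f x ∂expMeasure 1
      = ∫⁻ x, (Set.Ici (0 : ℝ)).indicator (fun x => ENNReal.ofReal (Real.exp (-x)) * f x) x := by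
  have h : expMeasure 1 = volume.withDensity (exponentialPDF 1) := rfl
  have hm : Measurable (exponentialPDF 1) := (measurable_exponentialPDFReal 1).ennreal_ofReal
  rw [h, lintegral_withDensity_eq_lintegral_mul _ hm hf]
  refine lintegral_congr fun x => ?_
  by_cases hx : 0 ≤ x
  · simp [hx, exponentialPDF_of_nonneg]
  · simp [hx, exponentialPDF_of_neg (not_le.1 hx)]

/-- Average of `f` at the time that precedes `t` by an exponential time of rate `r`. -/
noncomputable def delayAverage (r : ℝ) (f : ℝ → ℝ≥0∞) (t : ℝ) : ℝ≥0∞ :=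
  ∫⁻ x, f (t - x / r) ∂expMeasure 1

theorem lintegral_comp_sub_div {r : ℝ} (hr : 0 < r) (t : ℝ) {g : ℝ → ℝ≥0∞} (hg : Measurable g) :
    ∫⁻ x, g (t - x / r) = ENNReal.ofReal r * ∫⁻ y, g y := by
  rw [← lintegral_sub_left_eq_self g t]
  have h := Real.smul_map_volume_mul_right (a := r⁻¹) (inv_pos.2 hr).ne'
  have h2 : ∫⁻ x, g (t - x / r) = ∫⁻ y, g (t - y) ∂(Measure.map (· * r⁻¹) volume) := by
    rw [lintegral_map (by fun_prop) (by fun_prop)]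
    simp [div_eq_mul_inv]
  rw [h2]
  conv_rhs => rw [← h]
  rw [lintegral_smul_measure, smul_eq_mul, ← mul_assoc, ← ENNReal.ofReal_mul hr.le,
    abs_of_pos (inv_pos.2 hr), mul_inv_cancel₀ hr.ne', ENNReal.ofReal_one, one_mul]

/-- The substitution y = t - x / r gives a convolution with the exponential density, the form to
which Tonelli applies. -/
theorem delayAverage_eq {r : ℝ} (hr : 0 < r) {f : ℝ → ℝ≥0∞} (hf : Measurable f) (t : ℝ) :
    delayAverage r f t
      = ENNReal.ofReal r * ∫⁻ y, (Set.Iic t).indicator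
          (fun y => ENNReal.ofReal (Real.exp (-(r * (t - y)))) * f y) y := by
  rw [delayAverage, lintegral_expMeasure_one _ (by fun_prop), ← lintegral_comp_sub_div hr t]
  · refine lintegral_congr fun x => ?_
    by_cases hx : 0 ≤ x
    · have h1 : t - x / r ≤ t := by have := div_nonneg hx hr.le; linarith
      have h2 : r * (x / r) = x := by field_simp
      simp [Set.indicator, hx, h1, h2]
    · have h1 : ¬ t - x / r ≤ t := by
        have := div_neg_of_neg_of_pos (not_le.1 hx) hr
        linarith
      simp [Set.indicator, hx, h1]
  · exact Measurable.indicator (by fun_prop) measurableSet_Iic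

theorem lintegral_Icc_exp {r : ℝ} (hr : 0 < r) {y t : ℝ} (hyt : y ≤ t) :
    ENNReal.ofReal r * ∫⁻ s in Set.Icc y t, ENNReal.ofReal (Real.exp (-(r * (s - y))))
      = ENNReal.ofReal (1 - Real.exp (-(r * (t - y)))) := by
  rw [← ofReal_integral_eq_lintegral_ofReal, ← ENNReal.ofReal_mul hr.le,
    integral_Icc_eq_integral_Ioc, ← intervalIntegral.integral_of_le hyt]
  · congr 1
    rw [← intervalIntegral.integral_const_mul]
    have h : ∀ s ∈ Set.uIcc y t, HasDerivAt (fun s => -Real.exp (-(r * (s - y))))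
        (r * Real.exp (-(r * (s - y)))) s := fun s _ => by
      have h0 : HasDerivAt (fun s => -(r * (s - y))) (-r) s := by
        simpa [neg_mul] using ((hasDerivAt_id' s).sub_const y).const_mul (-r)
      convert! h0.exp.neg using 1
      ring
    rw [intervalIntegral.integral_eq_sub_of_hasDerivAt h
      (Continuous.intervalIntegrable (by fun_prop) _ _)]
    simp
    ring
  · exact Continuous.integrableOn_Icc (by fun_prop)
  · exact Filter.Eventually.of_forall fun s => (Real.exp_pos _).le

/-- Renewal identity: the events of a Poisson process of rate `r`, seen from time `t` backward, are
the first one, at an exponential distance, and those which follow an earlier one at an exponential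
distance. -/
theorem delayAverage_add {r : ℝ} (hr : 0 < r) {f : ℝ → ℝ≥0∞} (hf : Measurable f) (t : ℝ) :
    delayAverage r f t + ENNReal.ofReal r * ∫⁻ s in Set.Iic t, delayAverage r f s
      = ENNReal.ofReal r * ∫⁻ s in Set.Iic t, f s := by
  have hmeas : Measurable fun p : ℝ × ℝ => (Set.Iic p.1).indicator
      (fun y => ENNReal.ofReal (Real.exp (-(r * (p.1 - y)))) * f y) p.2 := by
    have : (fun p : ℝ × ℝ => (Set.Iic p.1).indicator
      (fun y => ENNReal.ofReal (Real.exp (-(r * (p.1 - y)))) * f y) p.2)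
      = {p : ℝ × ℝ | p.2 ≤ p.1}.indicator
        (fun p => ENNReal.ofReal (Real.exp (-(r * (p.1 - p.2)))) * f p.2) := by
      ext p; simp [Set.indicator]
    rw [this]
    exact Measurable.indicator (by fun_prop) (measurableSet_le measurable_snd measurable_fst)
  -- By Tonelli, s runs over [y, t] first and produces the exponential distribution function, whose
  -- weight complements the weight of f y in `delayAverage` at t.
  have h1 : ∫⁻ s in Set.Iic t, delayAverage r f s
      = ∫⁻ y in Set.Iic t, ENNReal.ofReal (1 - Real.exp (-(r * (t - y)))) * f y := by
    simp_rw [delayAverage_eq hr hf]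
    rw [lintegral_const_mul _ (by exact hmeas.lintegral_prod_right'),
      lintegral_lintegral_swap (by exact hmeas.aemeasurable),
      ← lintegral_const_mul _ (by
        exact Measurable.lintegral_prod_left' (μ := volume.restrict (Set.Iic t)) hmeas),
      ← lintegral_indicator measurableSet_Iic]
    refine lintegral_congr fun y => ?_
    by_cases hy : y ≤ t
    · have : ∀ s, (Set.Iic t).indicator (fun s => (Set.Iic s).indicator
          (fun y => ENNReal.ofReal (Real.exp (-(r * (s - y)))) * f y) y) s
          = (Set.Icc y t).indicator (fun s => ENNReal.ofReal (Real.exp (-(r * (s - y)))) * f y) s := by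
        intro s
        by_cases h1 : s ≤ t <;> by_cases h2 : y ≤ s <;> simp [Set.indicator, h1, h2]
      rw [← lintegral_indicator measurableSet_Iic, lintegral_congr this,
        lintegral_indicator measurableSet_Icc, lintegral_mul_const _ (by fun_prop), ← mul_assoc,
        lintegral_Icc_exp hr hy]
      simp [hy]
    · have : ∀ s, (Set.Iic t).indicator (fun s => (Set.Iic s).indicator
          (fun y => ENNReal.ofReal (Real.exp (-(r * (s - y)))) * f y) y) s = 0 := by
        intro s
        by_cases h1 : s ≤ t
        · simp [Set.indicator, h1, (lt_of_le_of_lt h1 (not_le.1 hy))]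
        · simp [Set.indicator, h1]
      rw [← lintegral_indicator measurableSet_Iic, lintegral_congr this]
      simp [hy]
  rw [h1, delayAverage_eq hr hf, lintegral_indicator measurableSet_Iic, ← mul_add,
    ← lintegral_add_left (by fun_prop)]
  congr 1
  refine setLIntegral_congr_fun measurableSet_Iic fun y hy => ?_
  have hy : y ≤ t := hy
  have : Real.exp (-(r * (t - y))) ≤ 1 := by
    rw [Real.exp_le_one_iff]
    have := mul_nonneg hr.le (sub_nonneg.2 hy)
    linarith
  rw [← add_mul, ← ENNReal.ofReal_add (Real.exp_pos _).le (by linarith)]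
  simp

theorem integral_exp_neg_div_expMeasure {r : ℝ} (hr : 0 < r) {s : ℂ} (hs : 0 ≤ s.re) :
    ∫ x, Complex.exp (-s * ((x / r : ℝ) : ℂ)) ∂expMeasure 1 = r / (r + s) := by
  have h : expMeasure 1 = volume.withDensity (exponentialPDF 1) := rfl
  have hm : Measurable (exponentialPDF 1) := (measurable_exponentialPDFReal 1).ennreal_ofReal
  have hr' : (r : ℂ) ≠ 0 := by exact_mod_cast hr.ne'
  have hrs : (r : ℂ) + s ≠ 0 := by
    intro h0
    have := congrArg Complex.re h0
    simp at this
    linarith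
  rw [h, integral_withDensity_eq_integral_toReal_smul hm
    (Filter.Eventually.of_forall fun x => by simp [exponentialPDF])]
  have : ∀ x : ℝ, (exponentialPDF 1 x).toReal • Complex.exp (-s * ((x / r : ℝ) : ℂ))
      = (Set.Ici (0 : ℝ)).indicator (fun x : ℝ => Complex.exp ((-1 - s / r) * x)) x := by
    intro x
    by_cases hx : 0 ≤ x
    · rw [exponentialPDF_of_nonneg hx, ENNReal.toReal_ofReal (by positivity)]
      simp only [Set.indicator, Set.mem_Ici, hx, if_true, Complex.real_smul]
      push_cast
      rw [one_mul, one_mul, ← Complex.exp_add]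
      congr 1
      ring
    · simp [hx, exponentialPDF_of_neg (not_le.1 hx)]
  simp_rw [this]
  rw [integral_indicator measurableSet_Ici, integral_Ici_eq_integral_Ioi,
    integral_exp_mul_complex_Ioi]
  · have : (1 : ℂ) + s / r = (r + s) / r := by field_simp
    rw [show (-1 - s / r : ℂ) = -((r + s) / r) by rw [← this]; ring]
    simp
  · have : (s / r).re = s.re / r := by simp
    simp [this]
    have := div_nonneg hs hr.le
    linarith

end SpeedQueue

namespace SpeedQueue

/-! ### Shifting the source of randomness -/

/-- Add the variables of one more jump in front of a source. -/
def prepend (a : unitInterval × ℝ) (ω : Source) : Source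
  | 0 => a
  | n + 1 => ω n

@[simp] theorem prepend_succ (a : unitInterval × ℝ) (ω : Source) (n : ℕ) :
    prepend a ω (n + 1) = ω n := rfl

theorem measurable_prepend :
    Measurable fun p : (unitInterval × ℝ) × Source => prepend p.1 p.2 := by
  refine measurable_pi_lambda _ fun n => ?_
  cases n with
  | zero => exact measurable_fst
  | succ n => exact (measurable_pi_apply n).comp measurable_snd

instance instIsProbabilityMeasureSourceLaw : IsProbabilityMeasure sourceLaw := by
  unfold sourceLaw; infer_instance

/-- This underlies every conditioning on the first jump. A product measure is determined by its
values on finite boxes, and on these the zeroth factor splits off. -/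
theorem sourceLaw_eq_map_prepend :
    sourceLaw = Measure.map (fun p => prepend p.1 p.2)
      (((volume : Measure unitInterval).prod (expMeasure 1)).prod sourceLaw) := by
  symm
  refine Measure.eq_infinitePi _ fun s t ht => ?_
  classical
  obtain ⟨N, hN⟩ : ∃ N, s ⊆ Finset.range (N + 1) :=
    ⟨s.sup id, fun i hi => Finset.mem_range.2 (Nat.lt_succ_of_le (Finset.le_sup (f := id) hi))⟩
  -- Padding with full factors makes the index set an initial segment, so that coordinate 0 is
  -- always present.
  set t' : ℕ → Set (unitInterval × ℝ) := fun i => if i ∈ s then t i else Set.univ with ht'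
  have hmeas : ∀ i, MeasurableSet (t' i) := fun i => by
    by_cases hi : i ∈ s
    · simpa [ht', hi] using ht i
    · simp [ht', hi]
  have hprod : ∏ i ∈ s, ((volume : Measure unitInterval).prod (expMeasure 1)) (t i)
      = ∏ i ∈ Finset.range (N + 1), ((volume : Measure unitInterval).prod (expMeasure 1)) (t' i) := by
    rw [← Finset.prod_subset hN fun i _ hi => by simp [ht', hi]]
    exact Finset.prod_congr rfl fun i hi => by simp [ht', hi]
  have hpre : (fun p : (unitInterval × ℝ) × Source => prepend p.1 p.2) ⁻¹' Set.pi s t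
      = t' 0 ×ˢ Set.pi (Finset.range N) fun i => t' (i + 1) := by
    have : Set.pi (s : Set ℕ) t = Set.pi (Finset.range (N + 1) : Set ℕ) t' := by
      ext x
      simp only [Set.mem_pi, Finset.mem_coe, ht']
      constructor
      · intro h i _
        by_cases hi : i ∈ s <;> simp [hi, h]
      · intro h i hi
        simpa [hi] using h i (hN hi)
    ext p
    rw [this, Set.mem_preimage, Set.mem_prod, Set.mem_pi, Set.mem_pi]
    constructor
    · intro h
      exact ⟨h 0 (by simp), fun i hi => h (i + 1) (by simpa using hi)⟩
    · rintro ⟨h0, h⟩ i hi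
      cases i with
      | zero => exact h0
      | succ i => exact h i (by simpa using hi)
  rw [Measure.map_apply measurable_prepend
    (MeasurableSet.pi s.countable_toSet fun i _ => ht i), hpre, Measure.prod_prod, hprod,
    Finset.prod_range_succ', mul_comm, sourceLaw, Measure.infinitePi_pi _ fun i _ => hmeas _]

/-- The holding time is integrated outermost to match the shape of `delayAverage`. -/
theorem lintegral_sourceLaw {f : Source → ℝ≥0∞} (hf : Measurable f) :
    ∫⁻ ω, f ω ∂sourceLaw
      = ∫⁻ x, (∫⁻ u : unitInterval, (∫⁻ ω, f (prepend (u, x) ω) ∂sourceLaw)) ∂expMeasure 1 := by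
  conv_lhs => rw [sourceLaw_eq_map_prepend]
  have h := hf.comp measurable_prepend
  rw [lintegral_map hf measurable_prepend, lintegral_prod _ (by exact h.aemeasurable),
    lintegral_prod_symm' _ (by exact h.lintegral_prod_right')]

theorem integral_sourceLaw {f : Source → ℂ} (hf : Measurable f) {C : ℝ} (hC : ∀ ω, ‖f ω‖ ≤ C) :
    ∫ ω, f ω ∂sourceLaw
      = ∫ x, (∫ u : unitInterval, (∫ ω, f (prepend (u, x) ω) ∂sourceLaw)) ∂expMeasure 1 := by
  conv_lhs => rw [sourceLaw_eq_map_prepend]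
  have h := hf.comp measurable_prepend
  have hint : Integrable (fun p : (unitInterval × ℝ) × Source => f (prepend p.1 p.2))
      (((volume : Measure unitInterval).prod (expMeasure 1)).prod sourceLaw) :=
    Integrable.of_bound h.aestronglyMeasurable C (Filter.Eventually.of_forall fun p => hC _)
  rw [integral_map measurable_prepend.aemeasurable hf.aestronglyMeasurable, integral_prod _ hint,
    integral_prod_symm _ hint.integral_prod_left]

/-! ### The path of the chain after the first jump -/

variable (q : SpeedQueue)

/-- State after a jump from `k` whose direction is decided by `u`. -/
noncomputable def nextState (k : ℕ) (u : unitInterval) : ℕ :=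
  if (u : ℝ) ≤ q.lam / q.totalRate k then k + 1 else k - 1

theorem state_prepend_succ (k : ℕ) (u : unitInterval) (x : ℝ) (ω : Source) (j : ℕ) :
    q.state k (prepend (u, x) ω) (j + 1) = q.state (q.nextState k u) ω j := by
  induction j with
  | zero => rfl
  | succ j ih =>
    rw [state, ih]
    rfl

theorem holdingTime_prepend_succ (k : ℕ) (u : unitInterval) (x : ℝ) (ω : Source) (j : ℕ) :
    q.holdingTime k (prepend (u, x) ω) (j + 1) = q.holdingTime (q.nextState k u) ω j := by
  rw [holdingTime, holdingTime, state_prepend_succ, prepend_succ]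

theorem jumpEpoch_prepend_succ (k : ℕ) (u : unitInterval) (x : ℝ) (ω : Source) (j : ℕ) :
    q.jumpEpoch k (prepend (u, x) ω) (j + 1)
      = x / q.totalRate k + q.jumpEpoch (q.nextState k u) ω j := by
  rw [jumpEpoch, Finset.sum_range_succ', jumpEpoch, add_comm]
  simp_rw [holdingTime_prepend_succ]
  rfl

theorem departures_prepend_succ (k : ℕ) (u : unitInterval) (x : ℝ) (ω : Source) (j i : ℕ) :
    q.departures k (prepend (u, x) ω) (j + 1) i = q.departures (q.nextState k u) ω j i := by
  unfold departures
  congr 2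
  ext l
  rw [show j + 1 + l + 1 = (j + l + 1) + 1 by ring, show j + 1 + l = (j + l) + 1 by ring,
    state_prepend_succ, state_prepend_succ]

theorem departureDelay_prepend_succ (k : ℕ) (u : unitInterval) (x : ℝ) (ω : Source) (j n : ℕ) :
    q.departureDelay k (prepend (u, x) ω) (j + 1) n
      = q.departureDelay (q.nextState k u) ω j n := by
  unfold departureDelay
  refine tsum_congr fun i => ?_
  rw [departures_prepend_succ, show j + 1 + i = (j + i) + 1 by ring, holdingTime_prepend_succ]

theorem departures_prepend_zero_succ (k : ℕ) (u : unitInterval) (x : ℝ) (ω : Source) (i : ℕ) :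
    q.departures k (prepend (u, x) ω) 0 (i + 1)
      = q.departures (q.nextState k u) ω 0 i + if q.nextState k u < k then 1 else 0 := by
  unfold departures
  simp_rw [Finset.card_filter]
  rw [Finset.sum_range_succ']
  congr 1
  refine Finset.sum_congr rfl fun l _ => ?_
  rw [show 0 + (l + 1) + 1 = (0 + l + 1) + 1 by ring, show 0 + (l + 1) = (0 + l) + 1 by ring,
    state_prepend_succ, state_prepend_succ]

/-- The first period always counts, as a departure is still awaited; only a downward jump then uses
one up. -/
theorem departureDelay_prepend_zero (k : ℕ) (u : unitInterval) (x : ℝ) (ω : Source) (n : ℕ) :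
    q.departureDelay k (prepend (u, x) ω) 0 (n + 1)
      = ENNReal.ofReal (x / q.totalRate k)
        + q.departureDelay (q.nextState k u) ω 0 (if q.nextState k u < k then n else n + 1) := by
  rw [departureDelay, tsum_eq_zero_add' ENNReal.summable, departureDelay]
  congr 1
  refine tsum_congr fun i => ?_
  rw [departures_prepend_zero_succ, show 0 + (i + 1) = (0 + i) + 1 by ring,
    holdingTime_prepend_succ]
  by_cases h : q.nextState k u < k <;> simp [h]

theorem departureDelay_zero (k : ℕ) (ω : Source) (j : ℕ) : q.departureDelay k ω j 0 = 0 := by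
  simp [departureDelay]

/-! ### Measurability -/

theorem measurable_state (k j : ℕ) : Measurable fun ω => q.state k ω j := by
  induction j with
  | zero => exact measurable_const
  | succ j ih =>
    simp only [state]
    refine Measurable.ite (measurableSet_le (by fun_prop) ?_) ?_ ?_
    · exact (Measurable.of_discrete (f := fun n => q.lam / q.totalRate n)).comp ih
    · exact (Measurable.of_discrete (f := fun n => n + 1)).comp ih
    · exact (Measurable.of_discrete (f := fun n => n - 1)).comp ih

theorem measurable_holdingTime (k j : ℕ) : Measurable fun ω => q.holdingTime k ω j := by
  unfold holdingTime
  exact Measurable.div (by fun_prop)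
    ((Measurable.of_discrete (f := q.totalRate)).comp (q.measurable_state k j))

theorem measurable_jumpEpoch (k j : ℕ) : Measurable fun ω => q.jumpEpoch k ω j :=
  Finset.measurable_sum _ fun i _ => q.measurable_holdingTime k i

theorem measurable_departures (k j i : ℕ) : Measurable fun ω => q.departures k ω j i := by
  unfold departures
  simp_rw [Finset.card_filter]
  exact Finset.measurable_sum _ fun l _ => Measurable.ite
    (measurableSet_lt (q.measurable_state k _) (q.measurable_state k _)) measurable_const
    measurable_const

/-- The number of awaited departures may be random because an arriving customer waits for as many as
the state just after the arrival. -/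
theorem measurable_departureDelay {n : Source → ℕ} (hn : Measurable n) (k j : ℕ) :
    Measurable fun ω => q.departureDelay k ω j (n ω) := by
  unfold departureDelay
  exact Measurable.tsum fun i => Measurable.ite
    (measurableSet_lt (q.measurable_departures k j i) hn)
    (q.measurable_holdingTime k _).ennreal_ofReal measurable_const

theorem measurable_taggedSojourn (n m : ℕ) : Measurable (q.taggedSojourn n m) :=
  q.measurable_departureDelay measurable_const _ _

theorem measurable_arrivalSojourn (j : ℕ) : Measurable (q.arrivalSojourn j) :=
  measurable_from_prod_countable_right fun k =>
    q.measurable_departureDelay (q.measurable_state k _) k _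

theorem measurableSet_arrivalInWindow (j : ℕ) : MeasurableSet (q.arrivalInWindow j) := by
  have h1 : Measurable fun p : ℕ × Source => q.state p.1 p.2 (j + 1) :=
    measurable_from_prod_countable_right fun k => q.measurable_state k _
  have h2 : Measurable fun p : ℕ × Source => q.state p.1 p.2 j + 1 :=
    measurable_from_prod_countable_right fun k =>
      (Measurable.of_discrete (f := fun n => n + 1)).comp (q.measurable_state k _)
  have h3 : Measurable fun p : ℕ × Source => q.jumpEpoch p.1 p.2 (j + 1) :=
    measurable_from_prod_countable_right fun k => q.measurable_jumpEpoch k _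
  exact (measurableSet_eq_fun h1 h2).inter (measurableSet_le h3 measurable_const)

end SpeedQueue

namespace SpeedQueue

/-! ### Rates and jump directions -/

/-- All rates of the queue are positive. -/
structure PositiveRates (q : SpeedQueue) : Prop where
  lam_pos : 0 < q.lam
  mu0_pos : 0 < q.mu0
  mu1_pos : 0 < q.mu1

variable {q : SpeedQueue}

theorem serviceRate_zero : q.serviceRate 0 = 0 := by simp [serviceRate]

theorem PositiveRates.serviceRate_succ_pos (hq : q.PositiveRates) (n : ℕ) :
    0 < q.serviceRate (n + 1) := by
  have := hq.mu0_pos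
  have := hq.mu1_pos
  rw [serviceRate, if_neg (Nat.succ_ne_zero n)]
  split_ifs <;> assumption

theorem PositiveRates.serviceRate_nonneg (hq : q.PositiveRates) (n : ℕ) :
    0 ≤ q.serviceRate n := by
  cases n with
  | zero => rw [serviceRate_zero]
  | succ n => exact (hq.serviceRate_succ_pos n).le

theorem PositiveRates.totalRate_pos (hq : q.PositiveRates) (n : ℕ) : 0 < q.totalRate n :=
  add_pos_of_pos_of_nonneg hq.lam_pos (hq.serviceRate_nonneg n)

theorem PositiveRates.totalRate_le (hq : q.PositiveRates) (n : ℕ) :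
    q.totalRate n ≤ q.lam + q.mu0 + q.mu1 := by
  have := hq.mu0_pos
  have := hq.mu1_pos
  unfold totalRate serviceRate
  split_ifs <;> linarith

theorem PositiveRates.ofReal_totalRate (hq : q.PositiveRates) (n : ℕ) :
    ENNReal.ofReal (q.totalRate n) = ENNReal.ofReal q.lam + ENNReal.ofReal (q.serviceRate n) :=
  ENNReal.ofReal_add hq.lam_pos.le (hq.serviceRate_nonneg n)

theorem PositiveRates.lam_div_mem (hq : q.PositiveRates) (k : ℕ) :
    q.lam / q.totalRate k ∈ unitInterval :=
  ⟨div_nonneg hq.lam_pos.le (hq.totalRate_pos k).le,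
    (div_le_one (hq.totalRate_pos k)).2 (le_add_of_nonneg_right (hq.serviceRate_nonneg k))⟩

theorem PositiveRates.one_sub_lam_div (hq : q.PositiveRates) (k : ℕ) :
    1 - q.lam / q.totalRate k = q.serviceRate k / q.totalRate k := by
  have := (hq.totalRate_pos k).ne'
  field_simp
  simp [totalRate]

theorem PositiveRates.lintegral_nextState (hq : q.PositiveRates) (k : ℕ) (F : ℕ → ℝ≥0∞) :
    ∫⁻ u, F (q.nextState k u)
      = ENNReal.ofReal (q.lam / q.totalRate k) * F (k + 1)
        + ENNReal.ofReal (q.serviceRate k / q.totalRate k) * F (k - 1) := by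
  set c : unitInterval := ⟨q.lam / q.totalRate k, hq.lam_div_mem k⟩ with hc
  have h : ∀ u, F (q.nextState k u)
      = (Set.Iic c).indicator (fun _ => F (k + 1)) u + (Set.Ioi c).indicator (fun _ => F (k - 1)) u := by
    intro u
    have hu : u ≤ c ↔ (u : ℝ) ≤ q.lam / q.totalRate k := Iff.rfl
    by_cases h : u ≤ c
    · simp [nextState, ← hu, h]
    · simp [nextState, ← hu, h, not_le.1 h]
  simp_rw [h]
  rw [lintegral_add_left (measurable_const.indicator measurableSet_Iic),
    lintegral_indicator measurableSet_Iic, lintegral_indicator measurableSet_Ioi,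
    setLIntegral_const, setLIntegral_const, unitInterval.volume_Iic, unitInterval.volume_Ioi,
    hc, hq.one_sub_lam_div, mul_comm, mul_comm (F (k - 1))]

theorem PositiveRates.integral_nextState (hq : q.PositiveRates) (k : ℕ) (F : ℕ → ℂ) :
    ∫ u, F (q.nextState k u)
      = (q.lam / q.totalRate k : ℝ) * F (k + 1)
        + (q.serviceRate k / q.totalRate k : ℝ) * F (k - 1) := by
  set c : unitInterval := ⟨q.lam / q.totalRate k, hq.lam_div_mem k⟩ with hc
  have h : ∀ u, F (q.nextState k u)
      = (Set.Iic c).indicator (fun _ => F (k + 1)) u + (Set.Ioi c).indicator (fun _ => F (k - 1)) u := by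
    intro u
    have hu : u ≤ c ↔ (u : ℝ) ≤ q.lam / q.totalRate k := Iff.rfl
    by_cases h : u ≤ c
    · simp [nextState, ← hu, h]
    · simp [nextState, ← hu, h, not_le.1 h]
  simp_rw [h]
  rw [integral_add ((integrable_const _).indicator measurableSet_Iic)
    ((integrable_const _).indicator measurableSet_Ioi),
    integral_indicator measurableSet_Iic, integral_indicator measurableSet_Ioi,
    setIntegral_const, setIntegral_const, measureReal_def, measureReal_def,
    unitInterval.volume_Iic, unitInterval.volume_Ioi, hc, hq.one_sub_lam_div,
    ENNReal.toReal_ofReal (hq.lam_div_mem k).1, ENNReal.toReal_ofReal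
      (div_nonneg (hq.serviceRate_nonneg k) (hq.totalRate_pos k).le),
    Complex.real_smul, Complex.real_smul]

/-! ### Arrivals with a given sojourn time -/

theorem sourceLaw_apply {S : Set Source} (hS : MeasurableSet S) :
    sourceLaw S
      = ∫⁻ x, (∫⁻ u : unitInterval, sourceLaw (prepend (u, x) ⁻¹' S)) ∂expMeasure 1 := by
  rw [← lintegral_indicator_one hS, lintegral_sourceLaw (measurable_one.indicator hS)]
  refine lintegral_congr fun x => lintegral_congr fun u => ?_
  have : Measurable (prepend (u, x)) := measurable_prepend.comp measurable_prodMk_left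
  rw [← lintegral_indicator_one (this hS)]
  rfl

variable (q) in
/-- The event that the `(j + 1)`-st jump from the initial state `k` is an arrival by time `t` whose
sojourn time lies in `A`. -/
def arrivalEvent (A : Set ℝ≥0∞) (j k : ℕ) (t : ℝ) : Set Source :=
  {ω | q.state k ω (j + 1) = q.state k ω j + 1 ∧ q.jumpEpoch k ω (j + 1) ≤ t ∧
    q.departureDelay k ω (j + 1) (q.state k ω (j + 1)) ∈ A}

variable (q) in
/-- Probability of `arrivalEvent`. -/
noncomputable def arrivalProb (A : Set ℝ≥0∞) (j k : ℕ) (t : ℝ) : ℝ≥0∞ :=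
  sourceLaw (q.arrivalEvent A j k t)

theorem measurableSet_arrivalEvent {A : Set ℝ≥0∞} (hA : MeasurableSet A) (j k : ℕ) (t : ℝ) :
    MeasurableSet (q.arrivalEvent A j k t) := by
  have h2 : Measurable fun ω : Source => q.state k ω j + 1 :=
    (Measurable.of_discrete (f := fun n => n + 1)).comp (q.measurable_state k j)
  exact (measurableSet_eq_fun (q.measurable_state k _) h2).inter
    ((measurableSet_le (q.measurable_jumpEpoch k _) measurable_const).inter
      (q.measurable_departureDelay (q.measurable_state k _) k _ hA))

/-- The event grows with t, so monotonicity suffices. -/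
theorem measurable_arrivalProb (A : Set ℝ≥0∞) (j k : ℕ) : Measurable (q.arrivalProb A j k) :=
  Monotone.measurable fun _ _ hst => measure_mono fun _ hω => ⟨hω.1, hω.2.1.trans hst, hω.2.2⟩

/-- A customer who arrives at the first jump takes position k + 1 with nobody behind, and the
remaining source is fresh. -/
theorem PositiveRates.arrivalProb_zero (hq : q.PositiveRates) {A : Set ℝ≥0∞}
    (hA : MeasurableSet A) (k : ℕ) (t : ℝ) :
    q.arrivalProb A 0 k t
      = delayAverage (q.totalRate k) ((Set.Ici 0).indicator fun _ =>
          ENNReal.ofReal (q.lam / q.totalRate k) * sourceLaw.map (q.taggedSojourn (k + 1) 0) A) t := by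
  rw [arrivalProb, sourceLaw_apply (measurableSet_arrivalEvent hA _ _ _), delayAverage]
  refine lintegral_congr fun x => ?_
  set F : ℕ → ℝ≥0∞ := fun n => if n = k + 1 then (Set.Ici 0).indicator (fun _ =>
    sourceLaw.map (q.taggedSojourn (k + 1) 0) A) (t - x / q.totalRate k) else 0 with hF
  have h : ∀ u : unitInterval,
      sourceLaw (prepend (u, x) ⁻¹' q.arrivalEvent A 0 k t) = F (q.nextState k u) := by
    intro u
    have hset : prepend (u, x) ⁻¹' q.arrivalEvent A 0 k t = {ω | q.nextState k u = k + 1 ∧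
        x / q.totalRate k ≤ t ∧ q.departureDelay (q.nextState k u) ω 0 (q.nextState k u) ∈ A} := by
      ext ω
      simp only [arrivalEvent, Set.mem_preimage, Set.mem_ofPred_eq, state_prepend_succ,
        jumpEpoch_prepend_succ, departureDelay_prepend_succ]
      simp [state, jumpEpoch]
    rw [hset]
    by_cases h1 : q.nextState k u = k + 1
    · by_cases h2 : x / q.totalRate k ≤ t
      · have : (0 : ℝ) ≤ t - x / q.totalRate k := sub_nonneg.2 h2
        simp only [h1, hF, h2, true_and, if_true, Set.indicator, Set.mem_Ici, this]
        rw [Measure.map_apply (q.measurable_taggedSojourn _ _) hA]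
        rfl
      · simp [h1, hF, h2, Set.indicator]
    · simp [h1, hF]
  simp_rw [h]
  rw [hq.lintegral_nextState]
  have : k - 1 ≠ k + 1 := by omega
  by_cases h2 : x / q.totalRate k ≤ t <;> simp [hF, this, Set.indicator, h2]

/-- After the first jump the chain starts anew, with one jump fewer to go and the holding time
deducted from t. -/
theorem PositiveRates.arrivalProb_succ (hq : q.PositiveRates) {A : Set ℝ≥0∞}
    (hA : MeasurableSet A) (j k : ℕ) (t : ℝ) :
    q.arrivalProb A (j + 1) k t
      = delayAverage (q.totalRate k) (fun s =>
          ENNReal.ofReal (q.lam / q.totalRate k) * q.arrivalProb A j (k + 1) s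
          + ENNReal.ofReal (q.serviceRate k / q.totalRate k) * q.arrivalProb A j (k - 1) s) t := by
  rw [arrivalProb, sourceLaw_apply (measurableSet_arrivalEvent hA _ _ _), delayAverage]
  refine lintegral_congr fun x => ?_
  rw [← hq.lintegral_nextState k fun n => q.arrivalProb A j n (t - x / q.totalRate k)]
  refine lintegral_congr fun u => ?_
  rw [arrivalProb]
  congr 1
  ext ω
  simp only [arrivalEvent, Set.mem_preimage, Set.mem_ofPred_eq, state_prepend_succ,
    jumpEpoch_prepend_succ, departureDelay_prepend_succ, le_sub_iff_add_le']

/-! ### Exponential decay in the number of jumps -/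

theorem setLIntegral_Iic_exp (t : ℝ) :
    ∫⁻ s in Set.Iic t, ENNReal.ofReal (Real.exp s) = ENNReal.ofReal (Real.exp t) := by
  rw [← ofReal_integral_eq_lintegral_ofReal (integrableOn_exp_Iic t)
    (Filter.Eventually.of_forall fun s => (Real.exp_pos s).le), integral_exp_Iic]

/-- Uniform bound for the Laplace transform at `1` of a holding time. -/
theorem delayAverage_exp_le {r R : ℝ} (hr : 0 < r) (hrR : r ≤ R) (t : ℝ) :
    delayAverage r (fun s => ENNReal.ofReal (Real.exp s)) t
      ≤ ENNReal.ofReal (R / (1 + R)) * ENNReal.ofReal (Real.exp t) := by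
  have hexp : ∀ t, delayAverage r (fun s => ENNReal.ofReal (Real.exp s)) t
      = delayAverage r (fun s => ENNReal.ofReal (Real.exp s)) 0 * ENNReal.ofReal (Real.exp t) := by
    intro t
    unfold delayAverage
    rw [← lintegral_mul_const _ (by fun_prop)]
    refine lintegral_congr fun x => ?_
    rw [← ENNReal.ofReal_mul (Real.exp_pos _).le, ← Real.exp_add]
    congr 2
    ring
  -- With M the average at 0, the renewal identity reads M + r M = r. Hence M = r / (1 + r), which
  -- increases with r.
  have h := delayAverage_add hr (f := fun s => ENNReal.ofReal (Real.exp s)) (by fun_prop) 0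
  rw [lintegral_congr hexp, lintegral_const_mul _ (by fun_prop), setLIntegral_Iic_exp] at h
  simp only [Real.exp_zero, ENNReal.ofReal_one, mul_one] at h
  rw [hexp]
  gcongr
  have h' : delayAverage r (fun s => ENNReal.ofReal (Real.exp s)) 0 * ENNReal.ofReal (1 + r)
      = ENNReal.ofReal r := by
    rw [ENNReal.ofReal_add zero_le_one hr.le, mul_add, ENNReal.ofReal_one, mul_one, mul_comm _
      (ENNReal.ofReal r), h]
  have hpos : ENNReal.ofReal (1 + r) ≠ 0 := by simp; linarith
  rw [(ENNReal.eq_div_iff hpos ENNReal.ofReal_ne_top).2 ((mul_comm _ _).trans h'),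
    ← ENNReal.ofReal_div_of_pos (by linarith)]
  refine ENNReal.ofReal_le_ofReal ?_
  rw [div_le_div_iff₀ (by linarith) (by linarith)]
  nlinarith

/-- A Chernoff bound: the indicator of t ≥ 0 is at most exp t, and each holding time multiplies exp
t by at most R / (1 + R), whatever the state. -/
theorem PositiveRates.arrivalProb_le (hq : q.PositiveRates) {A : Set ℝ≥0∞}
    (hA : MeasurableSet A) {R : ℝ} (hR : ∀ k, q.totalRate k ≤ R) (j k : ℕ) (t : ℝ) :
    q.arrivalProb A j k t ≤ ENNReal.ofReal (R / (1 + R)) ^ (j + 1) * ENNReal.ofReal (Real.exp t) := by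
  have hprob : ∀ k, ENNReal.ofReal (q.lam / q.totalRate k)
      + ENNReal.ofReal (q.serviceRate k / q.totalRate k) = 1 := fun k => by
    rw [← hq.one_sub_lam_div, ← ENNReal.ofReal_add (hq.lam_div_mem k).1
      (sub_nonneg.2 (hq.lam_div_mem k).2)]
    simp
  induction j generalizing k t with
  | zero =>
    rw [hq.arrivalProb_zero hA, zero_add, pow_one]
    refine le_trans (lintegral_mono fun x => ?_)
      (delayAverage_exp_le (hq.totalRate_pos k) (hR k) t)
    rw [Set.indicator_apply]
    split_ifs with hs
    swap
    · exact zero_le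
    have : IsProbabilityMeasure (sourceLaw.map (q.taggedSojourn (k + 1) 0)) :=
      Measure.isProbabilityMeasure_map (q.measurable_taggedSojourn _ _).aemeasurable
    calc ENNReal.ofReal (q.lam / q.totalRate k) * sourceLaw.map (q.taggedSojourn (k + 1) 0) A
        ≤ 1 * 1 :=
          mul_le_mul (ENNReal.ofReal_le_one.2 (hq.lam_div_mem k).2) prob_le_one zero_le zero_le
      _ = ENNReal.ofReal 1 := by simp
      _ ≤ ENNReal.ofReal (Real.exp (t - x / q.totalRate k)) :=
          ENNReal.ofReal_le_ofReal (Real.one_le_exp hs)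
  | succ j ih =>
    rw [hq.arrivalProb_succ hA]
    calc _ ≤ delayAverage (q.totalRate k) (fun s => ENNReal.ofReal (R / (1 + R)) ^ (j + 1)
            * ENNReal.ofReal (Real.exp s)) t := by
          refine lintegral_mono fun x => ?_
          have h (n : ℕ) := ih n (t - x / q.totalRate k)
          refine (add_le_add (mul_le_mul_right (h (k + 1)) _) (mul_le_mul_right (h (k - 1)) _)).trans
            (le_of_eq ?_)
          rw [← add_mul, hprob, one_mul]
      _ = ENNReal.ofReal (R / (1 + R)) ^ (j + 1)
            * delayAverage (q.totalRate k) (fun s => ENNReal.ofReal (Real.exp s)) t := by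
          unfold delayAverage
          rw [lintegral_const_mul _ (by fun_prop)]
      _ ≤ _ := by
          rw [pow_succ _ (j + 1), mul_assoc]
          gcongr
          exact delayAverage_exp_le (hq.totalRate_pos k) (hR k) t

end SpeedQueue

namespace SpeedQueue

/-! ### Arrivals see time averages -/

variable {q : SpeedQueue}

variable (q) in
/-- In the long run, the chain goes from `k` to `k + 1` as often as from `k + 1` to `k`. -/
def DetailedBalance (π : ℕ → ℝ≥0∞) : Prop :=
  ∀ k, π (k + 1) * ENNReal.ofReal (q.serviceRate (k + 1)) = π k * ENNReal.ofReal q.lam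

/-- An index shift turns the upward flow on the left into the service term on the right, and the
downward flow into the arrival term. The truncated 0 - 1 is harmless since the service rate at 0
vanishes. -/
theorem DetailedBalance.tsum_flow {π : ℕ → ℝ≥0∞} (hπ : q.DetailedBalance π) (F : ℕ → ℝ≥0∞) :
    ∑' k, π k * (ENNReal.ofReal q.lam * F (k + 1) + ENNReal.ofReal (q.serviceRate k) * F (k - 1))
      = ∑' k, π k * ((ENNReal.ofReal q.lam + ENNReal.ofReal (q.serviceRate k)) * F k) := by
  have h1 : ∑' k, π k * (ENNReal.ofReal q.lam * F (k + 1))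
      = ∑' k, π k * (ENNReal.ofReal (q.serviceRate k) * F k) := by
    rw [tsum_eq_zero_add' (f := fun k => π k * (ENNReal.ofReal (q.serviceRate k) * F k))
      ENNReal.summable]
    simp_rw [serviceRate_zero, ← mul_assoc, hπ _]
    simp
  have h2 : ∑' k, π k * (ENNReal.ofReal (q.serviceRate k) * F (k - 1))
      = ∑' k, π k * (ENNReal.ofReal q.lam * F k) := by
    rw [tsum_eq_zero_add' (f := fun k => π k * (ENNReal.ofReal (q.serviceRate k) * F (k - 1)))
      ENNReal.summable]
    simp_rw [serviceRate_zero, ← mul_assoc, hπ _]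
    simp
  simp_rw [mul_add, add_mul, mul_add]
  rw [ENNReal.tsum_add, ENNReal.tsum_add, h1, h2, add_comm]

theorem setLIntegral_Iic_indicator_Ici (t : ℝ) (c : ℝ≥0∞) :
    ∫⁻ s in Set.Iic t, (Set.Ici (0 : ℝ)).indicator (fun _ => c) s = c * ENNReal.ofReal t := by
  rw [lintegral_indicator measurableSet_Ici, Measure.restrict_restrict measurableSet_Ici,
    setLIntegral_const, Set.Ici_inter_Iic, Real.volume_Icc, sub_zero]

theorem PositiveRates.ofReal_totalRate_mul (hq : q.PositiveRates) (k : ℕ) (x : ℝ) :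
    ENNReal.ofReal (q.totalRate k) * ENNReal.ofReal (x / q.totalRate k) = ENNReal.ofReal x := by
  rw [← ENNReal.ofReal_mul (hq.totalRate_pos k).le, mul_div_cancel₀ _ (hq.totalRate_pos k).ne']

theorem PositiveRates.arrivalProb_zero_add (hq : q.PositiveRates) {A : Set ℝ≥0∞}
    (hA : MeasurableSet A) (k : ℕ) (t : ℝ) :
    q.arrivalProb A 0 k t
        + ENNReal.ofReal (q.totalRate k) * ∫⁻ s in Set.Iic t, q.arrivalProb A 0 k s
      = ENNReal.ofReal q.lam * ENNReal.ofReal t * sourceLaw.map (q.taggedSojourn (k + 1) 0) A := by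
  simp_rw [hq.arrivalProb_zero hA]
  rw [delayAverage_add (hq.totalRate_pos k) (measurable_const.indicator measurableSet_Ici),
    setLIntegral_Iic_indicator_Ici, ← mul_assoc, ← mul_assoc, hq.ofReal_totalRate_mul]
  ring

/-- The factor `totalRate k` from the renewal identity cancels the denominators of the jump
probabilities and leaves the rates that occur in detailed balance. -/
theorem PositiveRates.arrivalProb_succ_add (hq : q.PositiveRates) {A : Set ℝ≥0∞}
    (hA : MeasurableSet A) (j k : ℕ) (t : ℝ) :
    q.arrivalProb A (j + 1) k t
        + ENNReal.ofReal (q.totalRate k) * ∫⁻ s in Set.Iic t, q.arrivalProb A (j + 1) k s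
      = ENNReal.ofReal q.lam * (∫⁻ s in Set.Iic t, q.arrivalProb A j (k + 1) s)
        + ENNReal.ofReal (q.serviceRate k) * ∫⁻ s in Set.Iic t, q.arrivalProb A j (k - 1) s := by
  have h1 := measurable_arrivalProb (q := q) A j (k + 1)
  have h2 := measurable_arrivalProb (q := q) A j (k - 1)
  simp_rw [hq.arrivalProb_succ hA]
  rw [delayAverage_add (hq.totalRate_pos k) (by fun_prop), lintegral_add_left (by fun_prop),
    lintegral_const_mul _ h1, lintegral_const_mul _ h2, mul_add, ← mul_assoc, ← mul_assoc,
    hq.ofReal_totalRate_mul, hq.ofReal_totalRate_mul]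

/-- If the chain starts from a distribution in detailed balance, the expected number of arrivals by
time `t` with a sojourn time in `A` is `lam * t` times the probability that a customer who joins a
queue with that distribution has a sojourn time in `A`. -/
theorem PositiveRates.tsum_arrivalProb (hq : q.PositiveRates) {π : ℕ → ℝ≥0∞}
    (hπ : q.DetailedBalance π) (hsum : ∑' k, π k ≠ ∞) {A : Set ℝ≥0∞} (hA : MeasurableSet A)
    (t : ℝ) :
    ∑' j, ∑' k, π k * q.arrivalProb A j k t
      = ENNReal.ofReal q.lam * ENNReal.ofReal t
        * ∑' k, π k * sourceLaw.map (q.taggedSojourn (k + 1) 0) A := by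
  set a : ℕ → ℝ≥0∞ := fun j => ∑' k, π k * q.arrivalProb A j k t with ha
  set b : ℕ → ℝ≥0∞ := fun j => ∑' k, π k * (ENNReal.ofReal (q.totalRate k)
    * ∫⁻ s in Set.Iic t, q.arrivalProb A j k s) with hb
  have h0 : a 0 + b 0 = ENNReal.ofReal q.lam * ENNReal.ofReal t
      * ∑' k, π k * sourceLaw.map (q.taggedSojourn (k + 1) 0) A := by
    simp only [ha, hb]
    rw [← ENNReal.tsum_add, ← ENNReal.tsum_mul_left]
    refine tsum_congr fun k => ?_
    rw [← mul_add, hq.arrivalProb_zero_add hA]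
    ring
  -- Detailed balance enters here: the averaged inflow from the neighbours of k is the outflow from
  -- k, so the sum over j telescopes.
  have hsucc : ∀ j, a (j + 1) + b (j + 1) = b j := by
    intro j
    simp only [ha, hb]
    rw [← ENNReal.tsum_add]
    simp_rw [← mul_add, hq.arrivalProb_succ_add hA]
    rw [hπ.tsum_flow fun k => ∫⁻ s in Set.Iic t, q.arrivalProb A j k s]
    simp_rw [hq.ofReal_totalRate]
  have hpartial : ∀ J, ∑ j ∈ Finset.range (J + 1), a j + b J = a 0 + b 0 := by
    intro J
    induction J with
    | zero => simp
    | succ J ih => rw [Finset.sum_range_succ, add_assoc, hsucc, ih]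
  obtain ⟨R, hR⟩ : ∃ R, ∀ k, q.totalRate k ≤ R := ⟨_, hq.totalRate_le⟩
  have hR0 : 0 < R := (hq.totalRate_pos 0).trans_le (hR 0)
  set c : ℝ≥0∞ := ENNReal.ofReal (R / (1 + R)) with hc
  have hc1 : c < 1 := by
    rw [hc, ENNReal.ofReal_lt_one, div_lt_one (by linarith)]
    linarith
  have hble : ∀ J, b J ≤ (∑' k, π k) * (ENNReal.ofReal R * ENNReal.ofReal (Real.exp t))
      * c ^ (J + 1) := by
    intro J
    rw [← ENNReal.tsum_mul_right, ← ENNReal.tsum_mul_right]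
    refine ENNReal.tsum_le_tsum fun k => ?_
    rw [mul_assoc, mul_assoc]
    gcongr
    · exact hR k
    · calc ∫⁻ s in Set.Iic t, q.arrivalProb A J k s
          ≤ ∫⁻ s in Set.Iic t, c ^ (J + 1) * ENNReal.ofReal (Real.exp s) :=
            lintegral_mono fun s => hq.arrivalProb_le hA hR J k s
        _ = ENNReal.ofReal (Real.exp t) * c ^ (J + 1) := by
            rw [lintegral_const_mul _ (by fun_prop), setLIntegral_Iic_exp, mul_comm]
  -- The remainder vanishes: only finitely many jumps matter up to time t, quantified by the
  -- geometric bound.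
  have hb0 : Filter.Tendsto b Filter.atTop (nhds 0) := by
    refine tendsto_of_tendsto_of_tendsto_of_le_of_le tendsto_const_nhds ?_ (fun _ => zero_le) hble
    have h1 := (ENNReal.tendsto_pow_atTop_nhds_zero_of_lt_one hc1).comp (Filter.tendsto_add_atTop_nat 1)
    have h2 := ENNReal.Tendsto.const_mul (a := (∑' k, π k) *
      (ENNReal.ofReal R * ENNReal.ofReal (Real.exp t))) h1
      (Or.inr (ENNReal.mul_ne_top hsum (ENNReal.mul_ne_top ENNReal.ofReal_ne_top
        ENNReal.ofReal_ne_top)))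
    simpa using h2
  have hlim : Filter.Tendsto (fun J => ∑ j ∈ Finset.range (J + 1), a j + b J) Filter.atTop
      (nhds (∑' j, a j + 0)) :=
    ((ENNReal.tendsto_nat_tsum a).comp (Filter.tendsto_add_atTop_nat 1)).add hb0
  simp_rw [hpartial, h0, add_zero] at hlim
  exact (tendsto_nhds_unique hlim tendsto_const_nhds)

theorem arrivalMeasure_apply (π : PMF ℕ) {A : Set ℝ≥0∞} (hA : MeasurableSet A) :
    q.arrivalMeasure π A = ∑' j, ∑' k, π k * q.arrivalProb A j k 1 := by
  rw [arrivalMeasure, Measure.sum_apply _ hA]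
  refine tsum_congr fun j => ?_
  have hS := q.measurable_arrivalSojourn j hA
  rw [Measure.map_apply (q.measurable_arrivalSojourn j) hA, Measure.restrict_apply hS,
    Measure.prod_apply (hS.inter (q.measurableSet_arrivalInWindow j)), lintegral_countable']
  refine tsum_congr fun k => ?_
  rw [mul_comm, PMF.toMeasure_apply_singleton _ _ (measurableSet_singleton k), arrivalProb]
  congr 2
  ext ω
  simp only [arrivalEvent, arrivalInWindow, arrivalSojourn, Set.mem_preimage, Set.mem_inter_iff,
    Set.mem_ofPred_eq]
  tauto

theorem PositiveRates.arrivalMeasure_apply (hq : q.PositiveRates) {π : PMF ℕ}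
    (hπ : q.DetailedBalance π) {A : Set ℝ≥0∞} (hA : MeasurableSet A) :
    q.arrivalMeasure π A
      = ENNReal.ofReal q.lam * ∑' k, π k * sourceLaw.map (q.taggedSojourn (k + 1) 0) A := by
  rw [SpeedQueue.arrivalMeasure_apply π hA, hq.tsum_arrivalProb hπ
    (by rw [π.tsum_coe]; exact ENNReal.one_ne_top) hA, ENNReal.ofReal_one, mul_one]

/-- Arrivals see time averages: a typical customer finds `k` others with probability `π k`. -/
theorem PositiveRates.sojournLaw_eq (hq : q.PositiveRates) {π : PMF ℕ}
    (hπ : q.DetailedBalance π) :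
    q.sojournLaw π = Measure.sum fun k => π k • sourceLaw.map (q.taggedSojourn (k + 1) 0) := by
  have huniv : q.arrivalMeasure π Set.univ = ENNReal.ofReal q.lam := by
    rw [hq.arrivalMeasure_apply hπ MeasurableSet.univ]
    have : ∀ k, sourceLaw.map (q.taggedSojourn (k + 1) 0) Set.univ = 1 := fun k => by
      rw [Measure.map_apply (q.measurable_taggedSojourn _ _) MeasurableSet.univ]
      simp
    simp_rw [this, mul_one, π.tsum_coe, mul_one]
  ext A hA
  rw [sojournLaw, huniv, Measure.smul_apply, hq.arrivalMeasure_apply hπ hA,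
    Measure.sum_apply _ hA, smul_eq_mul, ← mul_assoc, ENNReal.inv_mul_cancel
      (by simpa using hq.lam_pos) ENNReal.ofReal_ne_top, one_mul]
  rfl

theorem PositiveRates.isProbabilityMeasure_sojournLaw (hq : q.PositiveRates) {π : PMF ℕ}
    (hπ : q.DetailedBalance π) : IsProbabilityMeasure (q.sojournLaw π) := by
  refine ⟨?_⟩
  rw [hq.sojournLaw_eq hπ, Measure.sum_apply _ MeasurableSet.univ]
  have : ∀ k, sourceLaw.map (q.taggedSojourn (k + 1) 0) Set.univ = 1 := fun k => by
    rw [Measure.map_apply (q.measurable_taggedSojourn _ _) MeasurableSet.univ]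
    simp
  simp_rw [Measure.smul_apply, this, smul_eq_mul, mul_one, π.tsum_coe]

end SpeedQueue

namespace SpeedQueue

/-! ### The stationary distribution -/

variable {q : SpeedQueue}

theorem hasSum_jumpRate_zero (p : ℕ → ℝ) :
    HasSum (fun n => p n * q.jumpRate n 0) (p 1 * q.serviceRate 1) := by
  have h := hasSum_single (f := fun n => p n * q.jumpRate n 0) 1 fun n hn => by
    simp [jumpRate, hn]
  simpa [jumpRate] using h

theorem hasSum_jumpRate_succ (p : ℕ → ℝ) (m : ℕ) :
    HasSum (fun n => p n * q.jumpRate n (m + 1))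
      (p m * q.lam + p (m + 2) * q.serviceRate (m + 2)) := by
  have h : HasSum (fun n => p n * q.jumpRate n (m + 1))
      (∑ n ∈ {m, m + 2}, p n * q.jumpRate n (m + 1)) :=
    hasSum_sum_of_ne_finset_zero fun n hn => by
      simp only [Finset.mem_insert, Finset.mem_singleton, not_or] at hn
      rw [jumpRate, if_neg (by omega), if_neg (by omega), mul_zero]
  rw [Finset.sum_pair (by omega)] at h
  simpa [jumpRate] using h

/-- Balance at 0 is already the first cut equation. Subtracting a cut equation from balance at the
next state gives the next cut equation; adding two adjacent ones gives balance back. -/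
theorem isStationary_iff_real (π : PMF ℕ) :
    q.IsStationary π ↔
      ∀ k, (π (k + 1)).toReal * q.serviceRate (k + 1) = (π k).toReal * q.lam := by
  set p : ℕ → ℝ := fun n => (π n).toReal
  constructor
  · intro h k
    induction k with
    | zero =>
      have := (h 0).unique (hasSum_jumpRate_zero p)
      rw [totalRate, serviceRate_zero, add_zero] at this
      exact this.symm
    | succ k ih =>
      have := (h (k + 1)).unique (hasSum_jumpRate_succ p k)
      simp only [totalRate, p] at this ih ⊢
      linarith
  · intro h m
    cases m with
    | zero =>
      have := hasSum_jumpRate_zero (q := q) p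
      simp only [p, h 0] at this
      simpa [totalRate, serviceRate_zero] using this
    | succ m =>
      have e : p m * q.lam + p (m + 2) * q.serviceRate (m + 2)
          = p (m + 1) * q.totalRate (m + 1) := by
        have h1 := h m
        have h2 := h (m + 1)
        simp only [totalRate, p] at h1 h2 ⊢
        linarith
      exact e ▸ hasSum_jumpRate_succ p m

theorem PositiveRates.detailedBalance (hq : q.PositiveRates) {π : PMF ℕ} (h : q.IsStationary π) :
    q.DetailedBalance π := by
  intro k
  have hk := (isStationary_iff_real π).1 h k
  rw [← ENNReal.toReal_eq_toReal_iff' (ENNReal.mul_ne_top (π.apply_ne_top _) ENNReal.ofReal_ne_top)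
    (ENNReal.mul_ne_top (π.apply_ne_top _) ENNReal.ofReal_ne_top), ENNReal.toReal_mul,
    ENNReal.toReal_mul, ENNReal.toReal_ofReal (hq.serviceRate_nonneg _),
    ENNReal.toReal_ofReal hq.lam_pos.le]
  exact hk

variable (q) in
/-- Solution of the detailed balance equations with value `1` at `0`. -/
noncomputable def weight (n : ℕ) : ℝ := ∏ i ∈ Finset.range n, q.lam / q.serviceRate (i + 1)

theorem weight_zero : q.weight 0 = 1 := by simp [weight]

theorem PositiveRates.weight_succ (hq : q.PositiveRates) (n : ℕ) :
    q.weight (n + 1) * q.serviceRate (n + 1) = q.weight n * q.lam := by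
  have := (hq.serviceRate_succ_pos n).ne'
  rw [weight, Finset.prod_range_succ, ← weight]
  field_simp

theorem PositiveRates.weight_nonneg (hq : q.PositiveRates) (n : ℕ) : 0 ≤ q.weight n :=
  Finset.prod_nonneg fun _ _ => div_nonneg hq.lam_pos.le (hq.serviceRate_nonneg _)

theorem weight_of_le {n : ℕ} (hn : n ≤ q.K) : q.weight n = (q.lam / q.mu0) ^ n := by
  rw [weight, Finset.prod_congr rfl fun i hi => ?_, Finset.prod_const, Finset.card_range]
  have := Finset.mem_range.1 hi
  rw [serviceRate, if_neg (by omega), if_pos (by omega)]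

theorem serviceRate_of_lt {n : ℕ} (hn : q.K < n) : q.serviceRate n = q.mu1 := by
  rw [serviceRate, if_neg (by omega), if_neg (by omega)]

theorem weight_add (h : ℕ) :
    q.weight (q.K + h) = (q.lam / q.mu0) ^ q.K * (q.lam / q.mu1) ^ h := by
  induction h with
  | zero => rw [add_zero, weight_of_le le_rfl, pow_zero, mul_one]
  | succ h ih =>
    rw [← add_assoc, weight, Finset.prod_range_succ, ← weight, ih, serviceRate_of_lt (by omega),
      pow_succ, mul_assoc]

variable (q) in
/-- Normalizing constant of the stationary distribution. -/
noncomputable def totalWeight : ℝ :=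
  ∑ n ∈ Finset.range (q.K + 1), (q.lam / q.mu0) ^ n
    + q.lam / (q.mu1 - q.lam) * (q.lam / q.mu0) ^ q.K

theorem PositiveRates.hasSum_weight (hq : q.PositiveRates) (hstable : q.lam < q.mu1) :
    HasSum q.weight q.totalWeight := by
  have hρ0 : 0 ≤ q.lam / q.mu1 := div_nonneg hq.lam_pos.le hq.mu1_pos.le
  have hρ1 : q.lam / q.mu1 < 1 := (div_lt_one hq.mu1_pos).2 hstable
  -- The tail starts at K + 1, whence the extra factor λ/μ₁.
  have h := (hasSum_geometric_of_lt_one hρ0 hρ1).mul_left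
    ((q.lam / q.mu0) ^ q.K * (q.lam / q.mu1))
  have hs : ∀ n, (q.lam / q.mu0) ^ q.K * (q.lam / q.mu1) * (q.lam / q.mu1) ^ n
      = q.weight (n + (q.K + 1)) := fun n => by
    rw [show n + (q.K + 1) = q.K + (n + 1) by ring, weight_add]
    ring
  simp_rw [hs] at h
  have h2 := (hasSum_nat_add_iff (q.K + 1)).1 h
  convert! h2 using 1
  rw [totalWeight, add_comm, Finset.sum_congr rfl fun n hn =>
    (weight_of_le (Nat.lt_succ_iff.1 (Finset.mem_range.1 hn))).symm]
  congr 1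
  have h1 := hq.mu1_pos.ne'
  have h2 : q.mu1 - q.lam ≠ 0 := (sub_pos.2 hstable).ne'
  rw [one_sub_div h1, inv_div]
  field_simp

theorem PositiveRates.totalWeight_pos (hq : q.PositiveRates) (hstable : q.lam < q.mu1) :
    0 < q.totalWeight := by
  have h := (hq.hasSum_weight hstable).summable.le_tsum 0 fun n _ => hq.weight_nonneg n
  rw [(hq.hasSum_weight hstable).tsum_eq, weight_zero] at h
  linarith

theorem PositiveRates.toReal_eq_mul_weight (hq : q.PositiveRates) {π : PMF ℕ}
    (h : q.IsStationary π) (n : ℕ) : (π n).toReal = (π 0).toReal * q.weight n := by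
  induction n with
  | zero => rw [weight_zero, mul_one]
  | succ n ih =>
    have h1 := (isStationary_iff_real π).1 h n
    have h2 := hq.weight_succ n
    have h3 := (hq.serviceRate_succ_pos n).ne'
    apply mul_right_cancel₀ h3
    rw [h1, ih, mul_assoc, mul_assoc, h2]

theorem PositiveRates.toReal_zero_eq (hq : q.PositiveRates) (hstable : q.lam < q.mu1) {π : PMF ℕ}
    (h : q.IsStationary π) : (π 0).toReal = q.totalWeight⁻¹ := by
  have h1 : ∑' n, (π n).toReal = 1 := by
    rw [← ENNReal.tsum_toReal_eq π.apply_ne_top, π.tsum_coe, ENNReal.toReal_one]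
  rw [tsum_congr (hq.toReal_eq_mul_weight h), tsum_mul_left, (hq.hasSum_weight hstable).tsum_eq] at h1
  exact eq_inv_of_mul_eq_one_left h1

theorem PositiveRates.existsUnique_isStationary (hq : q.PositiveRates) (hstable : q.lam < q.mu1) :
    ∃! π : PMF ℕ, q.IsStationary π := by
  have hW := hq.totalWeight_pos hstable
  have hnn : ∀ n, 0 ≤ q.weight n / q.totalWeight := fun n => div_nonneg (hq.weight_nonneg n) hW.le
  have hsum : HasSum (fun n => q.weight n / q.totalWeight) 1 := by
    simpa [div_self hW.ne'] using (hq.hasSum_weight hstable).div_const q.totalWeight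
  have hsum' : HasSum (fun n => ENNReal.ofReal (q.weight n / q.totalWeight)) 1 := by
    rw [ENNReal.summable.hasSum_iff, ← ENNReal.ofReal_tsum_of_nonneg hnn hsum.summable,
      hsum.tsum_eq, ENNReal.ofReal_one]
  refine ⟨⟨_, hsum'⟩, (isStationary_iff_real _).2 fun k => ?_, fun π hπ => ?_⟩
  · change (ENNReal.ofReal (q.weight (k + 1) / q.totalWeight)).toReal * _
      = (ENNReal.ofReal (q.weight k / q.totalWeight)).toReal * _
    rw [ENNReal.toReal_ofReal (hnn _), ENNReal.toReal_ofReal (hnn _), div_mul_eq_mul_div,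
      hq.weight_succ, div_mul_eq_mul_div]
  · ext n
    change π n = ENNReal.ofReal (q.weight n / q.totalWeight)
    rw [← ENNReal.ofReal_toReal (π.apply_ne_top n), hq.toReal_eq_mul_weight hπ,
      hq.toReal_zero_eq hstable hπ, div_eq_inv_mul]

end SpeedQueue

namespace SpeedQueue

/-! ### Laplace transforms -/

variable {q : SpeedQueue}

/-- The integrand `exp (-s x)` of the Laplace transform, with value `0` at `∞`. -/
noncomputable def expKernel (s : ℂ) (x : ℝ≥0∞) : ℂ :=
  if x = ∞ then 0 else Complex.exp (-s * (x.toReal : ℂ))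

theorem measurable_expKernel (s : ℂ) : Measurable (expKernel s) :=
  Measurable.ite (measurableSet_singleton _) measurable_const (by fun_prop)

theorem norm_expKernel_le {s : ℂ} (hs : 0 ≤ s.re) (x : ℝ≥0∞) : ‖expKernel s x‖ ≤ 1 := by
  unfold expKernel
  split_ifs
  · simp
  · rw [Complex.norm_exp, Real.exp_le_one_iff]
    have := mul_nonneg hs (ENNReal.toReal_nonneg (a := x))
    simpa

theorem expKernel_zero (s : ℂ) : expKernel s 0 = 1 := by simp [expKernel]

theorem expKernel_ofReal_add (s : ℂ) {y : ℝ} (hy : 0 ≤ y) (x : ℝ≥0∞) :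
    expKernel s (ENNReal.ofReal y + x) = Complex.exp (-s * y) * expKernel s x := by
  by_cases hx : x = ∞
  · simp [expKernel, hx]
  · rw [expKernel, if_neg (by simp [hx]), expKernel, if_neg hx,
      ENNReal.toReal_add ENNReal.ofReal_ne_top hx, ENNReal.toReal_ofReal hy, ← Complex.exp_add]
    push_cast
    ring_nf

theorem laplace_map {f : Source → ℝ≥0∞} (hf : Measurable f) (s : ℂ) :
    laplace (sourceLaw.map f) s = ∫ ω, expKernel s (f ω) ∂sourceLaw :=
  integral_map hf.aemeasurable (measurable_expKernel s).aestronglyMeasurable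

theorem psi_eq_integral (n m : ℕ) (s : ℂ) :
    q.psi n m s = ∫ ω, expKernel s (q.departureDelay (n + m) ω 0 n) ∂sourceLaw :=
  laplace_map (q.measurable_taggedSojourn n m) s

theorem psi_zero (m : ℕ) (s : ℂ) : q.psi 0 m s = 1 := by
  simp [psi_eq_integral, departureDelay_zero, expKernel_zero]

theorem norm_psi_le (n m : ℕ) {s : ℂ} (hs : 0 ≤ s.re) : ‖q.psi n m s‖ ≤ 1 := by
  rw [psi_eq_integral]
  simpa using norm_integral_le_of_norm_le_const (μ := sourceLaw)
    (Filter.Eventually.of_forall fun ω => norm_expKernel_le hs (q.departureDelay (n + m) ω 0 n))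

/-- Sources may contain negative numbers, which `ENNReal.ofReal` truncates to 0; almost surely none
occurs. -/
theorem ae_nonneg_expMeasure : ∀ᵐ x ∂expMeasure 1, (0 : ℝ) ≤ x := by
  have h : expMeasure 1 (Set.Iio 0) = 0 := by
    rw [← lintegral_indicator_one measurableSet_Iio,
      lintegral_expMeasure_one _ (measurable_one.indicator measurableSet_Iio)]
    have : ∀ x : ℝ, (Set.Ici (0 : ℝ)).indicator (fun x => ENNReal.ofReal (Real.exp (-x))
        * (Set.Iio (0 : ℝ)).indicator 1 x) x = 0 := fun x => by
      by_cases hx : 0 ≤ x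
      · simp [hx]
      · simp [hx]
    simp [this]
  rw [ae_iff]
  simpa [Set.Iio] using h

/-- First-step equation for the Laplace transform of the remaining sojourn time. -/
theorem PositiveRates.psi_succ (hq : q.PositiveRates) (n m : ℕ) {s : ℂ} (hs : 0 ≤ s.re) :
    q.psi (n + 1) m s
      = q.lam / (q.totalRate (n + 1 + m) + s) * q.psi (n + 1) (m + 1) s
        + q.serviceRate (n + 1 + m) / (q.totalRate (n + 1 + m) + s) * q.psi n m s := by
  set k := n + 1 + m with hk
  have hr := hq.totalRate_pos k
  -- Transform of the time left after a first jump to i; the direction of the jump fixes how many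
  -- departures are still awaited.
  set F : ℕ → ℂ := fun i =>
    ∫ ω, expKernel s (q.departureDelay i ω 0 (if i < k then n else n + 1)) ∂sourceLaw with hF
  have hup : F (k + 1) = q.psi (n + 1) (m + 1) s := by
    rw [psi_eq_integral, hF]
    simp only [if_neg (by omega : ¬ k + 1 < k)]
    rfl
  have hdown : F (k - 1) = q.psi n m s := by
    rw [psi_eq_integral, hF]
    simp only [if_pos (by omega : k - 1 < k)]
    rw [show k - 1 = n + m by omega]
  have hmeas : Measurable fun ω => expKernel s (q.departureDelay k ω 0 (n + 1)) :=
    (measurable_expKernel s).comp (q.measurable_departureDelay measurable_const k 0)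
  rw [psi_eq_integral, integral_sourceLaw hmeas fun ω => norm_expKernel_le hs _]
  have hstep : ∀ᵐ x ∂expMeasure 1, (∫ u : unitInterval, (∫ ω, expKernel s
      (q.departureDelay k (prepend (u, x) ω) 0 (n + 1)) ∂sourceLaw))
      = Complex.exp (-s * ((x / q.totalRate k : ℝ) : ℂ)) * ∫ u, F (q.nextState k u) := by
    filter_upwards [ae_nonneg_expMeasure] with x hx
    rw [← integral_const_mul]
    refine integral_congr_ae (Filter.Eventually.of_forall fun u => ?_)
    simp only [hF]
    rw [← integral_const_mul]
    refine integral_congr_ae (Filter.Eventually.of_forall fun ω => ?_)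
    simp only
    rw [departureDelay_prepend_zero, expKernel_ofReal_add s (div_nonneg hx hr.le)]
  rw [integral_congr_ae hstep, integral_mul_const, integral_exp_neg_div_expMeasure hr hs,
    hq.integral_nextState, hup, hdown]
  have hr' : (q.totalRate k : ℂ) ≠ 0 := by exact_mod_cast hr.ne'
  push_cast
  field_simp

/-- A bounded solution of a linear recursion that runs backward in time. -/
theorem hasSum_of_backward_recursion {a : ℂ} (ha : ‖a‖ < 1) {f d : ℕ → ℂ} {C : ℝ}
    (hf : ∀ m, ‖f m‖ ≤ C) (hrec : ∀ m, f m = a * f (m + 1) + d m) :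
    HasSum (fun m => a ^ m * d m) (f 0) := by
  -- The recursion bounds d in terms of f, so the series converges absolutely; iterating M times
  -- leaves a ^ M * f M, which tends to 0.
  have hd : ∀ m, ‖d m‖ ≤ C + C := fun m => by
    rw [show d m = f m - a * f (m + 1) by rw [hrec m]; ring]
    refine (norm_sub_le _ _).trans (add_le_add (hf m) ?_)
    rw [norm_mul]
    exact (mul_le_of_le_one_left (norm_nonneg _) ha.le).trans (hf _)
  have hsum : Summable fun m => a ^ m * d m := by
    refine Summable.of_norm_bounded
      ((summable_geometric_of_lt_one (norm_nonneg a) ha).mul_right (C + C)) fun m => ?_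
    rw [norm_mul, norm_pow]
    exact mul_le_mul_of_nonneg_left (hd m) (by positivity)
  rw [hsum.hasSum_iff_tendsto_nat]
  have hpartial : ∀ M, ∑ m ∈ Finset.range M, a ^ m * d m = f 0 - a ^ M * f M := by
    intro M
    induction M with
    | zero => simp
    | succ M ih => rw [Finset.sum_range_succ, ih, hrec M]; ring
  simp_rw [hpartial]
  have h0 : Filter.Tendsto (fun M => a ^ M * f M) Filter.atTop (nhds 0) := by
    refine squeeze_zero_norm (a := fun M => ‖a‖ ^ M * C) (fun M => ?_) ?_
    · rw [norm_mul, norm_pow]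
      exact mul_le_mul_of_nonneg_left (hf M) (by positivity)
    · simpa using (tendsto_pow_atTop_nhds_zero_of_lt_one (norm_nonneg a) ha).mul_const C
  simpa using h0.const_sub (f 0)

theorem ofReal_add_ne_zero {c : ℝ} (hc : 0 < c) {s : ℂ} (hs : 0 ≤ s.re) : (c : ℂ) + s ≠ 0 := by
  intro h
  have := congrArg Complex.re h
  simp at this
  linarith

theorem norm_ofReal_div_lt_one {b c : ℝ} (hb : 0 < b) (hbc : b < c) {s : ℂ} (hs : 0 ≤ s.re) :
    ‖(b : ℂ) / (c + s)‖ < 1 := by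
  have h : c ≤ ‖(c : ℂ) + s‖ := by
    have := Complex.re_le_norm ((c : ℂ) + s)
    simp at this
    linarith
  rw [norm_div, div_lt_one (by linarith), Complex.norm_real, Real.norm_of_nonneg hb.le]
  linarith

/-! ### Sojourn times above the threshold -/

theorem PositiveRates.psi_succ_of_lt (hq : q.PositiveRates) {n m : ℕ} (hnm : q.K < n + 1 + m)
    {s : ℂ} (hs : 0 ≤ s.re) :
    q.psi (n + 1) m s
      = q.lam / ((q.lam + q.mu1 : ℝ) + s) * q.psi (n + 1) (m + 1) s
        + q.mu1 / ((q.lam + q.mu1 : ℝ) + s) * q.psi n m s := by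
  rw [hq.psi_succ n m hs, totalRate, serviceRate_of_lt hnm]

/-- As long as at least `K` customers are behind, services are completed at the high rate. -/
theorem PositiveRates.psi_of_le (hq : q.PositiveRates) (n : ℕ) {m : ℕ} (hm : q.K ≤ m) {s : ℂ}
    (hs : 0 ≤ s.re) : q.psi n m s = (q.mu1 / (q.mu1 + s)) ^ n := by
  induction n generalizing m with
  | zero => rw [psi_zero, pow_zero]
  | succ n ih =>
    have hpos : 0 < q.lam + q.mu1 := add_pos hq.lam_pos hq.mu1_pos
    have ha : ‖(q.lam : ℂ) / ((q.lam + q.mu1 : ℝ) + s)‖ < 1 :=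
      norm_ofReal_div_lt_one hq.lam_pos (lt_add_of_pos_right _ hq.mu1_pos) hs
    -- The induction hypothesis holds for every m ≥ K, so the inhomogeneous term is constant and the
    -- solution is a geometric series.
    have h := hasSum_of_backward_recursion ha (f := fun i => q.psi (n + 1) (m + i) s)
      (d := fun _ => q.mu1 / ((q.lam + q.mu1 : ℝ) + s) * (q.mu1 / (q.mu1 + s)) ^ n)
      (fun i => norm_psi_le _ _ hs) fun i => by
        rw [hq.psi_succ_of_lt (by omega) hs, ih (by omega)]
        rfl
    have h2 := (hasSum_geometric_of_norm_lt_one ha).mul_right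
      (q.mu1 / ((q.lam + q.mu1 : ℝ) + s) * (q.mu1 / (q.mu1 + s)) ^ n)
    rw [add_zero] at h
    rw [h.unique h2, pow_succ]
    have h3 := ofReal_add_ne_zero hpos hs
    have h4 := ofReal_add_ne_zero hq.mu1_pos hs
    rw [one_sub_div h3, show ((q.lam + q.mu1 : ℝ) : ℂ) + s - q.lam = q.mu1 + s by push_cast; ring]
    field_simp

/-- Customers who find more than `K` others: after their position has dropped to `K`, the number
of customers behind is geometrically weighted. -/
theorem PositiveRates.hasSum_psi_add (hq : q.PositiveRates) (hstable : q.lam < q.mu1) {s : ℂ}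
    (hs : 0 ≤ s.re) :
    HasSum (fun m => ((q.lam : ℂ) / (q.mu1 + s)) ^ m * (q.mu1 / (q.mu1 + s) * q.psi q.K m s))
      (∑' h, ((q.lam : ℂ) / q.mu1) ^ h * q.psi (q.K + h + 1) 0 s) := by
  set ρ : ℂ := (q.lam : ℂ) / q.mu1 with hρ
  have hρ1 : ‖ρ‖ < 1 := by
    simpa [hρ] using norm_ofReal_div_lt_one hq.lam_pos hstable (s := 0) (by simp)
  have hle : ∀ n m h, ‖ρ ^ h * q.psi n m s‖ ≤ ‖ρ‖ ^ h := fun n m h => by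
    rw [norm_mul, norm_pow]
    exact mul_le_of_le_one_right (by positivity) (norm_psi_le _ _ hs)
  have hgeo := summable_geometric_of_lt_one (norm_nonneg ρ) hρ1
  have hsum : ∀ (n : ℕ → ℕ) m, Summable fun h => ρ ^ h * q.psi (n h) m s := fun n m =>
    Summable.of_norm_bounded hgeo fun h => hle _ _ _
  set G : ℕ → ℂ := fun m => ∑' h, ρ ^ h * q.psi (q.K + h + 1) m s with hG
  refine hasSum_of_backward_recursion (f := G) (C := ∑' h, ‖ρ‖ ^ h)
    (norm_ofReal_div_lt_one hq.lam_pos hstable hs)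
    (fun m => tsum_of_norm_bounded hgeo.hasSum fun h => hle _ _ _) fun m => ?_
  -- Lowering the position by one shifts the sum back onto G, up to the boundary term at position K.
  have h1 : ∑' h, ρ ^ h * q.psi (q.K + h) m s = q.psi q.K m s + ρ * G m := by
    rw [(hsum (fun h => q.K + h) m).tsum_eq_zero_add, hG, ← tsum_mul_left]
    congr 1
    · simp
    · refine tsum_congr fun h => ?_
      rw [pow_succ, add_assoc]
      ring
  have h2 : G m = q.lam / ((q.lam + q.mu1 : ℝ) + s) * G (m + 1)
      + q.mu1 / ((q.lam + q.mu1 : ℝ) + s) * (q.psi q.K m s + ρ * G m) := by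
    rw [← h1, hG]
    simp only
    rw [← tsum_mul_left, ← tsum_mul_left, ← Summable.tsum_add
      ((hsum (fun h => q.K + h + 1) (m + 1)).mul_left _) ((hsum (fun h => q.K + h) m).mul_left _)]
    refine tsum_congr fun h => ?_
    rw [hq.psi_succ_of_lt (by omega) hs]
    ring
  have h3 := ofReal_add_ne_zero (add_pos hq.lam_pos hq.mu1_pos) hs
  have h4 := ofReal_add_ne_zero hq.mu1_pos hs
  have h5 : (q.mu1 : ℂ) ≠ 0 := by exact_mod_cast hq.mu1_pos.ne'
  have h6 : (q.mu1 : ℂ) * ρ = q.lam := by rw [hρ]; field_simp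
  -- Since μ₁ρ = λ, the terms λ G m cancel, and the coefficient λ + μ₁ + s becomes μ₁ + s.
  have h7 : (q.lam + q.mu1 + s) * G m = q.lam * G (m + 1) + q.mu1 * q.psi q.K m s + q.lam * G m := by
    push_cast at h2 h3
    calc (q.lam + q.mu1 + s) * G m = (q.lam + q.mu1 + s) * (_ + _) := by rw [← h2]
      _ = _ := by field_simp; rw [← h6]; ring
  field_simp
  linear_combination h7

/-- The series in m is cut at m = K, beyond which ψ(K, m, s) is explicit. One γ^K comes from the cut
and one from ψ, hence the exponent 2K. -/
theorem PositiveRates.tsum_psi_tail (hq : q.PositiveRates) (hstable : q.lam < q.mu1) {s : ℂ}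
    (hs : 0 ≤ s.re) :
    ∑' h, ((q.lam : ℂ) / q.mu1) ^ h * q.psi (q.K + h + 1) 0 s
      = ∑ h ∈ Finset.range q.K, ((q.lam : ℂ) / q.mu1) ^ h * ((q.mu1 : ℂ) / (q.mu1 + s)) ^ (h + 1)
          * q.psi q.K h s
        + ((q.lam : ℂ) / q.mu1) ^ q.K * ((q.mu1 : ℂ) / (q.mu1 - q.lam))
          * ((q.mu1 : ℂ) / (q.mu1 + s)) ^ (2 * q.K)
          * (((q.mu1 : ℂ) - q.lam) / (q.mu1 - q.lam + s)) := by
  have h4 := ofReal_add_ne_zero hq.mu1_pos hs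
  have h5 : (q.mu1 : ℂ) ≠ 0 := by exact_mod_cast hq.mu1_pos.ne'
  have h6 := ofReal_add_ne_zero (sub_pos.2 hstable) hs
  have h7 : (q.mu1 : ℂ) - q.lam ≠ 0 := by exact_mod_cast (sub_pos.2 hstable).ne'
  push_cast at h6
  set γ : ℂ := (q.mu1 : ℂ) / (q.mu1 + s) with hγ
  set ρ : ℂ := (q.lam : ℂ) / q.mu1 with hρ
  have hα : (q.lam : ℂ) / (q.mu1 + s) = ρ * γ := by rw [hρ, hγ]; field_simp
  have hα1 : ‖ρ * γ‖ < 1 := hα ▸ norm_ofReal_div_lt_one hq.lam_pos hstable hs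
  have h := hq.hasSum_psi_add hstable hs
  rw [hα] at h
  rw [← h.tsum_eq, ← h.summable.sum_add_tsum_nat_add q.K]
  congr 1
  · refine Finset.sum_congr rfl fun i _ => ?_
    rw [mul_pow]
    ring
  · simp_rw [hq.psi_of_le q.K (Nat.le_add_left q.K _) hs, ← hγ, pow_add]
    rw [tsum_congr fun i => mul_assoc _ _ _, tsum_mul_right, tsum_geometric_of_norm_lt_one hα1,
      ← hα, one_sub_div h4, inv_div, hα, show (q.mu1 : ℂ) + s - q.lam = q.mu1 - q.lam + s by ring,
      mul_pow, two_mul, pow_add]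
    have hγ' : (q.mu1 + s) * γ = q.mu1 := by rw [hγ]; field_simp
    field_simp
    linear_combination (ρ ^ q.K * γ ^ q.K * γ ^ q.K) * hγ'

theorem PositiveRates.laplace_sojournLaw (hq : q.PositiveRates) {π : PMF ℕ}
    (hπ : q.IsStationary π) {s : ℂ} (hs : 0 ≤ s.re) :
    HasSum (fun k => ((π k).toReal : ℂ) * q.psi (k + 1) 0 s) (laplace (q.sojournLaw π) s) := by
  have hprob := hq.isProbabilityMeasure_sojournLaw (hq.detailedBalance hπ)
  have hint : Integrable (expKernel s) (q.sojournLaw π) :=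
    Integrable.of_bound (measurable_expKernel s).aestronglyMeasurable 1
      (Filter.Eventually.of_forall fun x => norm_expKernel_le hs x)
  rw [hq.sojournLaw_eq (hq.detailedBalance hπ)] at hint ⊢
  have h := hasSum_integral_measure hint
  simp_rw [integral_smul_measure, Complex.real_smul] at h
  exact h

end SpeedQueue

/-! ### The stationary sojourn time -/

theorem proposition1 (q : SpeedQueue) (hlam : 0 < q.lam) (hmu0 : 0 < q.mu0)
    (hstable : q.lam < q.mu1) :
    (∃! π : PMF ℕ, q.IsStationary π) ∧
    ∀ π : PMF ℕ, q.IsStationary π →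
      (π 0).toReal = (∑ n ∈ Finset.range (q.K + 1), (q.lam / q.mu0) ^ n
          + q.lam / (q.mu1 - q.lam) * (q.lam / q.mu0) ^ q.K)⁻¹ ∧
      MeasureTheory.IsProbabilityMeasure (q.sojournLaw π) ∧
      ∀ s : ℂ, 0 ≤ s.re →
        SpeedQueue.laplace (q.sojournLaw π) s =
          ((π 0).toReal : ℂ) * ∑ h ∈ Finset.range q.K,
              (((q.lam : ℂ) / q.mu0) ^ h * q.psi (h + 1) 0 s
                + ((q.lam : ℂ) / q.mu0) ^ q.K * ((q.lam : ℂ) / q.mu1) ^ h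
                  * ((q.mu1 : ℂ) / (q.mu1 + s)) ^ (h + 1) * q.psi q.K h s)
            + ((π 0).toReal : ℂ) * ((q.lam : ℂ) / q.mu0) ^ q.K * ((q.lam : ℂ) / q.mu1) ^ q.K
                * ((q.mu1 : ℂ) / (q.mu1 - q.lam)) * ((q.mu1 : ℂ) / (q.mu1 + s)) ^ (2 * q.K)
                * (((q.mu1 : ℂ) - q.lam) / (q.mu1 - q.lam + s)) := by
  have hq : q.PositiveRates := ⟨hlam, hmu0, hlam.trans hstable⟩
  refine ⟨hq.existsUnique_isStationary hstable, fun π hπ => ⟨hq.toReal_zero_eq hstable hπ,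
    hq.isProbabilityMeasure_sojournLaw (hq.detailedBalance hπ), fun s hs => ?_⟩⟩
  have h := hq.laplace_sojournLaw hπ hs
  rw [← h.tsum_eq, ← h.summable.sum_add_tsum_nat_add q.K]
  -- The tail begins at state K itself: a customer who finds K others raises the number to K + 1,
  -- where service is at the high rate.
  have htail : ∀ i, ((π (i + q.K)).toReal : ℂ) * q.psi (i + q.K + 1) 0 s
      = ((π 0).toReal : ℂ) * ((q.lam : ℂ) / q.mu0) ^ q.K
        * (((q.lam : ℂ) / q.mu1) ^ i * q.psi (q.K + i + 1) 0 s) := fun i => by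
    rw [hq.toReal_eq_mul_weight hπ, add_comm i, SpeedQueue.weight_add]
    push_cast
    ring
  have hhead : ∀ i ∈ Finset.range q.K, ((π i).toReal : ℂ) * q.psi (i + 1) 0 s
      = ((π 0).toReal : ℂ) * (((q.lam : ℂ) / q.mu0) ^ i * q.psi (i + 1) 0 s) := fun i hi => by
    rw [hq.toReal_eq_mul_weight hπ, SpeedQueue.weight_of_le (Finset.mem_range.1 hi).le]
    push_cast
    ring
  rw [tsum_congr htail, tsum_mul_left, hq.tsum_psi_tail hstable hs, Finset.sum_congr rfl hhead,
    ← Finset.mul_sum, Finset.sum_add_distrib]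
  simp_rw [mul_assoc (((q.lam : ℂ) / q.mu0) ^ q.K)]
  rw [← Finset.mul_sum]
  ring
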